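/- Let $M\ge 1$ be an integer and $\Omega_M=\{0,1,\dots,M\}^{\mathbb N}$, $\mathbb N=\{1,2,\dots\}$, with the lexicographic order $\prec$, $\preceq$ and the left shift $\sigma$. For words $c,d$ over $\{0,\dots,M\}$ write $c\prec d$ if $c0^\infty\prec d0^\infty$, and $c\preceq d$ if $c\prec d$ or $c=d$. The reflection of a word or sequence is obtained by replacing each digit $x$ by $M-x$ and is denoted by an overline. For a word $w=w_1\dots w_k$ let $w^+=w_1\dots w_{k-1}(w_k+1)$ if $w_k<M$ and $w^-=w_1\dots w_{k-1}(w_k-1)$ if $w_k>0$. Put $$\mathcal V=\{s\in\Omega_M:\ \overline{s}\preceq\sigma^n(s)\preceq s\ \text{ for all } n\ge 0\}.$$ A sequence $(s_i)\in\mathcal V$ is called *irreducible* if for every $j\in\mathbb N$, $$s_j>0\ \text{ and }\ (s_1\dots s_j^-)^\infty\in\mathcal V\quad\Longrightarrow\quad s_1\dots s_j\big(\overline{s_1\dots s_j}^{\,+}\big)^\infty\prec(s_i).$$ A word $a=a_1\dots a_m\in\{0,\dots,M\}^m$ with $m\ge2$ is *fundamental* if $\overline{a_1\dots a_{m-i}}\preceq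 a_{i+1}\dots a_m\prec a_1\dots a_{m-i}$ for all $1\le i<m$; when $M\ge2$, the one-letter word $a_1$ is *fundamental* if $M-a_1\le a_1<M$. Let $\mathcal A_M$ be the set of fundamental words over $\{0,\dots,M\}$; in particular $\mathcal A_1$ is the set of fundamental words over $\{0,1\}$ (all of which begin with $1$). For $c\in\mathcal A_M$ consider the directed graph with vertices $\mathrm{Start},A,B$ and the following edges, each carrying a block and a digit: $$\mathrm{Start}\xrightarrow{\,c^+/\,1\,}A,\quad A\xrightarrow{\,\overline{c}\,/\,1\,}A,\quad A\xrightarrow{\,\overline{c^+}\,/\,0\,}B,\quad B\xrightarrow{\,c\,/\,0\,}B,\quad B\xrightarrow{\,c^+/\,1\,}A.$$ For $d\in\mathcal A_1$ there is exactly one path from $\mathrm{Start}$ whose digits spell $d$; the *composition* $c\circ d$ is the concatenation of the blocks along this path. **Proposition.** Let $a\in\mathcal A_M$. Then the sequence $a^\infty=aaa\cdots$ is irreducible if and only if there do not exist $c\in\mathcal A_M$ and $d\in\mathcal A_1$ such that $a=c\circ d$. -/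

import Mathlib

namespace FundamentalWord

/-! The alphabet `{0, 1, …, M}` is `Fin (M + 1)`, words are lists and infinite sequences are
functions on `ℕ` (so the first digit has index `0`).  Infinite sequences are compared in Mathlib's
lexicographic order, through `toLex`. -/

section Words

variable {M : ℕ}

/-- The reflection of a word: every digit `d` becomes `M - d`. -/
def reflect (w : List (Fin (M + 1))) : List (Fin (M + 1)) := w.map Fin.rev

/-- The reflection of an infinite sequence. -/
def reflectSeq (s : ℕ → Fin (M + 1)) : ℕ → Fin (M + 1) := fun i => Fin.rev (s i)

/-- `w⁺`: the last digit is increased by one.  Meaningful when `w` is nonempty and its last digit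
is less than `M`; it is used only on such words. -/
def plus (w : List (Fin (M + 1))) : List (Fin (M + 1)) := w.modify (w.length - 1) (· + 1)

/-- `w⁻`: the last digit is decreased by one.  Meaningful when `w` is nonempty and its last digit
is positive; it is used only on such words. -/
def minus (w : List (Fin (M + 1))) : List (Fin (M + 1)) := w.modify (w.length - 1) (· - 1)

/-- The concatenation of a word with an infinite sequence. -/
def appendSeq (w : List (Fin (M + 1))) (s : ℕ → Fin (M + 1)) : ℕ → Fin (M + 1) :=
  fun i => if h : i < w.length then w[i] else s (i - w.length)

/-- The periodic sequence `w^∞ = www⋯` for a nonempty word `w`. -/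
def periodicSeq (w : List (Fin (M + 1))) : ℕ → Fin (M + 1) :=
  fun i => w.getD (i % w.length) 0

/-- The left shift iterated `n` times. -/
def shift (n : ℕ) (s : ℕ → Fin (M + 1)) : ℕ → Fin (M + 1) := fun i => s (i + n)

/-- The word formed by the first `n` digits of a sequence. -/
def initialWord (s : ℕ → Fin (M + 1)) (n : ℕ) : List (Fin (M + 1)) :=
  List.ofFn fun i : Fin n => s i

/-- `c ≺ d` for words: `c0^∞` is lexicographically smaller than `d0^∞`. -/
def WordLT (c d : List (Fin (M + 1))) : Prop :=
  toLex (appendSeq c fun _ => 0) < toLex (appendSeq d fun _ => 0)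

/-- `c ≼ d` for words. -/
def WordLE (c d : List (Fin (M + 1))) : Prop := WordLT c d ∨ c = d

end Words

/-- The set `𝒱` of all sequences `s` with `reflectSeq s ≼ σⁿ s ≼ s` for all `n ≥ 0`. -/
def V (M : ℕ) : Set (ℕ → Fin (M + 1)) :=
  {s | ∀ n : ℕ, toLex (reflectSeq s) ≤ toLex (shift n s) ∧ toLex (shift n s) ≤ toLex s}

/-- Irreducibility of a sequence in the sense of Alcaraz Barrera, Baker and Kong.  The index `j`
here counts from `0`, so the prefix that ends in the digit `s j` has length `j + 1`. -/
def IsIrreducibleSeq {M : ℕ} (s : ℕ → Fin (M + 1)) : Prop :=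
  s ∈ V M ∧ ∀ j : ℕ, 0 < s j → periodicSeq (minus (initialWord s (j + 1))) ∈ V M →
    toLex (appendSeq (initialWord s (j + 1))
      (periodicSeq (plus (reflect (initialWord s (j + 1)))))) < toLex s

/-- The set `𝒜_M` of fundamental words with alphabet `{0, 1, …, M}`. -/
def fundamentalWords (M : ℕ) : Set (List (Fin (M + 1))) :=
  {a | (2 ≤ a.length ∧ ∀ i : ℕ, 1 ≤ i → i < a.length →
          WordLE (reflect (a.take (a.length - i))) (a.drop i) ∧
          WordLT (a.drop i) (a.take (a.length - i))) ∨
       (2 ≤ M ∧ ∃ d : Fin (M + 1), a = [d] ∧ Fin.rev d ≤ d ∧ d < Fin.last M)}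

/-! The directed graph with vertices `Start`, `A`, `B` and edges `e₀, …, e₄`, and its two
labelings. -/

inductive Vertex
  | start
  | A
  | B

inductive Edge
  | e0
  | e1
  | e2
  | e3
  | e4

/-- The initial vertex of an edge. -/
def Edge.src : Edge → Vertex
  | .e0 => .start
  | .e1 => .A
  | .e2 => .B
  | .e3 => .B
  | .e4 => .A

/-- The terminal vertex of an edge. -/
def Edge.dst : Edge → Vertex
  | .e0 => .A
  | .e1 => .B
  | .e2 => .B
  | .e3 => .A
  | .e4 => .A

/-- The labeling by the blocks `a`, `a⁺`, and their reflections. -/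
def Edge.block {M : ℕ} (a : List (Fin (M + 1))) : Edge → List (Fin (M + 1))
  | .e0 => plus a
  | .e1 => reflect (plus a)
  | .e2 => a
  | .e3 => plus a
  | .e4 => reflect a

/-- The labeling by digits `0` and `1`. -/
def Edge.digit : Edge → Fin (1 + 1)
  | .e0 => 1
  | .e1 => 0
  | .e2 => 0
  | .e3 => 1
  | .e4 => 1

/-- `p` is a path in the graph that begins at the vertex `v`. -/
def IsPath : Vertex → List Edge → Prop
  | _, [] => True
  | v, e :: p => e.src = v ∧ IsPath e.dst p

/-- `IsPhi a w b` says that `Φ_a(w) = b`: there is a path beginning at `Start` along which the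
blocks spell `w` and the digits spell `b`. -/
def IsPhi {M : ℕ} (a w : List (Fin (M + 1))) (b : List (Fin (1 + 1))) : Prop :=
  ∃ p : List Edge, IsPath .start p ∧ (p.map (Edge.block a)).flatten = w ∧ p.map Edge.digit = b

/-- The edge that leaves a given vertex and carries a given digit (from `Start` only the digit `1`
can be read; the digit `0` is given a junk value there). -/
def nextEdge : Vertex → Fin (1 + 1) → Edge
  | .start, _ => .e0
  | .A, d => if d = 0 then .e1 else .e4
  | .B, d => if d = 0 then .e2 else .e3

/-- The path beginning at `v` whose digits spell `b`. -/
def pathOf : Vertex → List (Fin (1 + 1)) → List Edge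
  | _, [] => []
  | v, d :: b => nextEdge v d :: pathOf (nextEdge v d).dst b

/-- The composition `a ∘ b = Φ_a⁻¹(b)` for `a ∈ 𝒜_M`, `b ∈ 𝒜_1` (every such `b` begins with the
digit `1`): the word spelled by the blocks along the path from `Start` whose digits spell `b`. -/
def comp {M : ℕ} (a : List (Fin (M + 1))) (b : List (Fin (1 + 1))) : List (Fin (M + 1)) :=
  ((pathOf .start b).map (Edge.block a)).flatten

theorem isPath_iff_eq_pathOf (v : Vertex) (hv : v ≠ .start) (b : List (Fin (1 + 1)))
    (p : List Edge) : IsPath v p ∧ p.map Edge.digit = b ↔ p = pathOf v b := by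
  induction b generalizing v p with
  | nil => cases p <;> simp [IsPath, pathOf]
  | cons d b ih =>
    cases p with
    | nil => simp [pathOf]
    | cons e p =>
      have h := ih e.dst (by cases e <;> simp [Edge.dst]) p
      fin_cases d <;> cases v <;> cases e <;>
        simp_all [IsPath, pathOf, nextEdge, Edge.src, Edge.dst, Edge.digit]

/-- For a word `b` that begins with the digit `1`, the composition `a ∘ b` is the unique word `w`
with `Φ_a(w) = b`. -/
theorem isPhi_iff_eq_comp {M : ℕ} (a w : List (Fin (M + 1))) (b : List (Fin (1 + 1))) :
    IsPhi a w (1 :: b) ↔ w = comp a (1 :: b) := by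
  have key : ∀ p : List Edge, IsPath .start p ∧ p.map Edge.digit = 1 :: b ↔
      p = pathOf .start (1 :: b) := by
    intro p
    cases p with
    | nil => simp [pathOf]
    | cons e p =>
      have h := isPath_iff_eq_pathOf e.dst (by cases e <;> simp [Edge.dst]) b p
      cases e <;> simp_all [IsPath, pathOf, nextEdge, Edge.src, Edge.dst, Edge.digit]
  constructor
  · rintro ⟨p, h1, h2, h3⟩
    rw [← h2, (key p).1 ⟨h1, h3⟩, comp]
  · rintro rfl
    obtain ⟨h1, h2⟩ := (key _).2 rfl
    exact ⟨_, h1, rfl, h2⟩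

/-- Irreducibility of a fundamental word: it is not a composition `c ∘ d` with `c ∈ 𝒜_M` and
`d ∈ 𝒜_1`. -/
def IsIrreducibleWord {M : ℕ} (a : List (Fin (M + 1))) : Prop :=
  ¬ ∃ c ∈ fundamentalWords M, ∃ d ∈ fundamentalWords 1, a = comp c d

end FundamentalWord

namespace FundamentalWord

/-! ### Binary digits -/

section Binary

/-! Put s = a^∞. If a = c ∘ d, then s starts with c⁺, followed by copies of c̄ until the first 0 of
d emits the reflection of c⁺, which is smaller than c̄ in its last digit. Hence s ≺ c⁺c̄^∞, while
c^∞ ∈ 𝒱, so the prefix c⁺ violates irreducibility (`not_isIrreducibleSeq_comp`).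

Conversely, let a prefix c⁺ violate irreducibility: p = c^∞ lies in 𝒱 and s ≼ c⁺c̄^∞. Each tail of s
at a block boundary, reflected when the graph is at A, is squeezed between p and s. These first
differ at the last digit of the block, by one, so the next block is c or c⁺ up to that reflection,
and the squeeze passes to the next tail (`first_block`, `toLex_le_twist_shift`). Thus s is spelled
by a path, and the states after its blocks are the digits of the candidate d.

It remains that a ends at a block boundary and that c and d are fundamental. A period not divisible
by |c| would create overlaps of c and c⁺ that 𝒱 forbids (`dvd_of_periodic`). From a fixed state,
spelling preserves order (`lt_of_states_lt`), so the inequalities of 𝒱 descend from s to the states;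
primitivity of a makes the upper ones strict for d. -/

theorem eq_zero_or_one (x : Fin (1 + 1)) : x = 0 ∨ x = 1 := by decide +revert

theorem eq_zero_of_lt {x y : Fin (1 + 1)} (h : x < y) : x = 0 := by decide +revert

theorem eq_one_of_lt {x y : Fin (1 + 1)} (h : x < y) : y = 1 := by decide +revert

end Binary

/-! ### Lexicographic order on sequences -/

section Lexicographic

variable {α : Type*} [LinearOrder α]

theorem toLex_lt_iff (x y : ℕ → α) :
    toLex x < toLex y ↔ ∃ k, (∀ i < k, x i = y i) ∧ x k < y k :=
  Iff.rfl

theorem toLex_le_iff (x y : ℕ → α) :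
    toLex x ≤ toLex y ↔ ∀ k, (∀ i < k, x i = y i) → x k ≤ y k := by
  refine (not_lt.symm.trans (not_congr (toLex_lt_iff y x))).trans ?_
  push Not
  exact forall_congr' fun k =>
    ⟨fun h h' => h fun i hi => (h' i hi).symm, fun h h' => h fun i hi => (h' i hi).symm⟩

/-- A sequence lying between two sequences with a common prefix has the same prefix. -/
theorem eq_of_toLex_le_of_le {x y z : ℕ → α} {n : ℕ} (hxy : toLex x ≤ toLex y)
    (hyz : toLex y ≤ toLex z) (h : ∀ i < n, x i = z i) : ∀ i < n, y i = x i := by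
  rw [toLex_le_iff] at hxy hyz
  intro i
  induction i using Nat.strong_induction_on with
  | _ i ih =>
    intro hi
    refine le_antisymm ?_ (hxy i fun k hk => (ih k hk (hk.trans hi)).symm)
    rw [h i hi]
    exact hyz i fun k hk => (ih k hk (hk.trans hi)).trans (h k (hk.trans hi))

/-- Cancelling a common prefix. -/
theorem toLex_drop_le {x y : ℕ → α} (n : ℕ) (h : toLex x ≤ toLex y) (he : ∀ i < n, x i = y i) :
    toLex (fun i => x (i + n)) ≤ toLex (fun i => y (i + n)) := by
  rw [toLex_le_iff] at h ⊢
  intro k hk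
  refine h _ fun i hi => ?_
  by_cases hin : i < n
  · exact he i hin
  · have := hk (i - n) (by omega)
    rwa [Nat.sub_add_cancel (by omega)] at this

end Lexicographic

/-! ### Words, prefixes, reflection and change of the last digit -/

section Words

variable {M : ℕ}

/-- Reflection is an order-reversing involution. This turns the lower bound in 𝒱 into an upper bound
on reflected tails. -/
theorem toLex_reflectSeq_le_comm {x y : ℕ → Fin (M + 1)} :
    toLex (reflectSeq x) ≤ toLex y ↔ toLex (reflectSeq y) ≤ toLex x := by
  simp only [toLex_le_iff, reflectSeq]
  refine forall_congr' fun k => ?_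
  rw [Fin.rev_le_iff]
  refine imp_congr_left (forall₂_congr fun i _ => ?_)
  rw [Fin.rev_eq_iff, eq_comm]

theorem toLex_le_reflectSeq_comm {x y : ℕ → Fin (M + 1)} :
    toLex x ≤ toLex (reflectSeq y) ↔ toLex y ≤ toLex (reflectSeq x) := by
  simp only [toLex_le_iff, reflectSeq]
  refine forall_congr' fun k => ?_
  rw [Fin.le_rev_iff]
  refine imp_congr_left (forall₂_congr fun i _ => ?_)
  rw [eq_comm, Fin.rev_eq_iff]

theorem shift_one_shift (n : ℕ) (s : ℕ → Fin (M + 1)) : shift 1 (shift n s) = shift (n + 1) s :=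
  funext fun i => congrArg s (by omega)

theorem appendSeq_zero (w : List (Fin (M + 1))) (i : ℕ) :
    appendSeq w (fun _ => 0) i = w.getD i 0 := by
  unfold appendSeq
  split_ifs with h <;> simp [h]

theorem length_initialWord (s : ℕ → Fin (M + 1)) (n : ℕ) : (initialWord s n).length = n := by
  simp [initialWord]

theorem getElem_initialWord (s : ℕ → Fin (M + 1)) (n i : ℕ) (h : i < (initialWord s n).length) :
    (initialWord s n)[i] = s i := by
  simp [initialWord]

theorem getD_initialWord {s : ℕ → Fin (M + 1)} {n i : ℕ} (h : i < n) :
    (initialWord s n).getD i 0 = s i := by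
  rw [List.getD_eq_getElem _ _ (by simpa [length_initialWord] using h), getElem_initialWord]

theorem eq_initialWord_iff {s : ℕ → Fin (M + 1)} {w : List (Fin (M + 1))} {n : ℕ} :
    w = initialWord s n ↔ w.length = n ∧ ∀ i (h : i < w.length), w[i] = s i := by
  constructor
  · rintro rfl
    exact ⟨length_initialWord _ _, fun i h => getElem_initialWord _ _ _ _⟩
  · rintro ⟨h1, h2⟩
    refine List.ext_getElem (by simpa [length_initialWord] using h1) fun i hi _ => ?_
    rw [h2, getElem_initialWord]

theorem initialWord_congr {s t : ℕ → Fin (M + 1)} {n : ℕ} :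
    initialWord s n = initialWord t n ↔ ∀ i < n, s i = t i := by
  rw [eq_initialWord_iff]
  simp [length_initialWord, getElem_initialWord]

theorem initialWord_add (s : ℕ → Fin (M + 1)) (m n : ℕ) :
    initialWord s (m + n) = initialWord s m ++ initialWord (shift m s) n := by
  symm
  rw [eq_initialWord_iff]
  refine ⟨by simp [length_initialWord], fun i h => ?_⟩
  rw [List.getElem_append]
  split_ifs with hi
  · exact getElem_initialWord _ _ _ _
  · rw [getElem_initialWord]
    simp only [length_initialWord, shift] at hi ⊢
    rw [Nat.sub_add_cancel (not_lt.1 hi)]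

theorem drop_initialWord (s : ℕ → Fin (M + 1)) (m r : ℕ) :
    (initialWord s m).drop r = initialWord (shift r s) (m - r) := by
  rw [eq_initialWord_iff]
  refine ⟨by simp [length_initialWord], fun i h => ?_⟩
  simp [getElem_initialWord, shift, add_comm]

theorem take_initialWord {s : ℕ → Fin (M + 1)} {m r : ℕ} (h : r ≤ m) :
    (initialWord s m).take r = initialWord s r := by
  rw [eq_initialWord_iff]
  refine ⟨by simp [length_initialWord, h], fun i h => ?_⟩
  simp [getElem_initialWord]

theorem reflect_initialWord (s : ℕ → Fin (M + 1)) (m : ℕ) :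
    reflect (initialWord s m) = initialWord (reflectSeq s) m := by
  simp [reflect, initialWord, reflectSeq, List.map_ofFn, Function.comp_def]

theorem wordLT_initialWord_iff {s t : ℕ → Fin (M + 1)} {n : ℕ} :
    WordLT (initialWord s n) (initialWord t n) ↔
      ∃ k < n, (∀ i < k, s i = t i) ∧ s k < t k := by
  unfold WordLT
  rw [toLex_lt_iff]
  simp only [appendSeq_zero]
  refine exists_congr fun k => ?_
  by_cases hk : k < n
  · simp only [hk, true_and, getD_initialWord]
    refine and_congr_left fun _ => forall₂_congr fun i hi => ?_
    rw [getD_initialWord (hi.trans hk), getD_initialWord (hi.trans hk)]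
  · have : ∀ x : ℕ → Fin (M + 1), (initialWord x n).getD k 0 = 0 := fun x =>
      List.getD_eq_default _ _ (by simpa [length_initialWord] using hk)
    simp only [this, lt_irrefl, and_false, hk, false_and]

theorem wordLE_initialWord_iff {s t : ℕ → Fin (M + 1)} {n : ℕ} :
    WordLE (initialWord s n) (initialWord t n) ↔
      ∀ k < n, (∀ i < k, s i = t i) → s k ≤ t k := by
  unfold WordLE
  rw [wordLT_initialWord_iff, initialWord_congr]
  constructor
  · rintro (⟨k, _, h1, h2⟩ | h) k' hk' h'
    · rcases lt_trichotomy k k' with h | rfl | h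
      · exact absurd (h' k h) h2.ne
      · exact h2.le
      · exact (h1 _ h).le
    · exact (h k' hk').le
  · intro h
    by_contra! hcon
    obtain ⟨h1, h2⟩ := hcon
    have : ∀ i < n, s i = t i := by
      intro i
      induction i using Nat.strong_induction_on with
      | _ i ih =>
        intro hi
        have hb : ∀ k < i, s k = t k := fun k hk => ih k hk (hk.trans hi)
        exact le_antisymm (h i hi hb) (h1 i hi hb)
    obtain ⟨i, hi, hne⟩ := h2
    exact hne (this i hi)

theorem periodicSeq_apply_of_lt {w : List (Fin (M + 1))} {i : ℕ} (h : i < w.length) :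
    periodicSeq w i = w[i] := by
  unfold periodicSeq
  rw [Nat.mod_eq_of_lt h, List.getD_eq_getElem _ _ h]

theorem periodicSeq_add_length (w : List (Fin (M + 1))) (i : ℕ) :
    periodicSeq w (i + w.length) = periodicSeq w i := by
  simp [periodicSeq]

theorem initialWord_periodicSeq (w : List (Fin (M + 1))) :
    initialWord (periodicSeq w) w.length = w := by
  symm
  rw [eq_initialWord_iff]
  exact ⟨rfl, fun i h => (periodicSeq_apply_of_lt h).symm⟩

theorem reflectSeq_periodicSeq {w : List (Fin (M + 1))} (hw : 0 < w.length) :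
    reflectSeq (periodicSeq w) = periodicSeq (reflect w) := by
  funext i
  have h : i % w.length < w.length := Nat.mod_lt _ hw
  simp [reflectSeq, periodicSeq, reflect, h]

theorem length_plus (w : List (Fin (M + 1))) : (plus w).length = w.length := by
  simp [plus]

theorem length_minus (w : List (Fin (M + 1))) : (minus w).length = w.length := by
  simp [minus]

theorem length_reflect (w : List (Fin (M + 1))) : (reflect w).length = w.length := by
  simp [reflect]

/-- No bound on the last digit is needed, because addition in `Fin (M + 1)` is cyclic. -/
theorem minus_plus (w : List (Fin (M + 1))) : minus (plus w) = w := by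
  refine List.ext_getElem (by simp [minus, plus]) fun i _ _ => ?_
  simp only [minus, plus, List.getElem_modify, List.length_modify]
  split_ifs <;> simp

theorem plus_minus (w : List (Fin (M + 1))) : plus (minus w) = w := by
  refine List.ext_getElem (by simp [minus, plus]) fun i _ _ => ?_
  simp only [minus, plus, List.getElem_modify, List.length_modify]
  split_ifs <;> simp

theorem fin_rev_add_one (x : Fin (M + 1)) : (x + 1).rev + 1 = x.rev := by
  rcases Nat.eq_zero_or_pos M with rfl | hM
  · exact Subsingleton.elim (α := Fin 1) _ _
  · by_cases hx : x = Fin.last M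
    · subst hx
      simp
    · ext
      have := Fin.val_add_one_of_lt (lt_of_le_of_ne (Fin.le_last x) hx)
      have hx' : x.val < M := lt_of_le_of_ne (Fin.le_last x) fun h => hx (Fin.ext h)
      have h2 : (x + 1).rev < Fin.last M := by
        rw [Fin.lt_def, Fin.val_rev, this, Fin.val_last]; omega
      rw [Fin.val_add_one_of_lt h2, Fin.val_rev, Fin.val_rev, this]
      omega

/-- Reflection turns the increment into a decrement, which the outer increment cancels. For the
prefix c⁺ the comparison sequence in the definition of irreducibility is therefore c⁺c̄^∞. -/
theorem plus_reflect_plus (w : List (Fin (M + 1))) : plus (reflect (plus w)) = reflect w := by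
  refine List.ext_getElem (by simp [reflect, plus]) fun i _ _ => ?_
  simp only [reflect, plus, List.getElem_modify, List.length_modify, List.getElem_map,
    List.length_map]
  split_ifs <;> simp [fin_rev_add_one]

theorem getElem_plus_of_lt (w : List (Fin (M + 1))) (i : ℕ) (h : i + 1 < w.length) :
    (plus w)[i]'(by rw [length_plus]; omega) = w[i] := by
  simp only [plus, List.getElem_modify]
  rw [if_neg (by omega)]

theorem getElem_minus_of_lt (w : List (Fin (M + 1))) (i : ℕ) (h : i + 1 < w.length) :
    (minus w)[i]'(by rw [length_minus]; omega) = w[i] := by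
  simp only [minus, List.getElem_modify]
  rw [if_neg (by omega)]

theorem getElem_plus_last (w : List (Fin (M + 1))) (i : ℕ) (h : i + 1 = w.length) :
    (plus w)[i]'(by rw [length_plus]; omega) = w[i] + 1 := by
  simp only [plus, List.getElem_modify]
  rw [if_pos (by omega)]

theorem getElem_minus_last (w : List (Fin (M + 1))) (i : ℕ) (h : i + 1 = w.length) :
    (minus w)[i]'(by rw [length_minus]; omega) = w[i] - 1 := by
  simp only [minus, List.getElem_modify]
  rw [if_pos (by omega)]

end Words

/-! ### Fundamental words and their periodic sequences -/

section Fundamental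

variable {M : ℕ}

/-- Fundamental words of length at least two, in terms of a sequence that they begin. -/
theorem initialWord_mem_fundamentalWords_iff {s : ℕ → Fin (M + 1)} {m : ℕ} (hm : 2 ≤ m) :
    initialWord s m ∈ fundamentalWords M ↔ ∀ r, 1 ≤ r → r < m →
      (∀ k < m - r, (∀ i < k, (s i).rev = s (i + r)) → (s k).rev ≤ s (k + r)) ∧
      ∃ k < m - r, (∀ i < k, s (i + r) = s i) ∧ s (k + r) < s k := by
  have hl := length_initialWord s m
  have key : ∀ r < m, (WordLE (reflect ((initialWord s m).take ((initialWord s m).length - r)))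
      ((initialWord s m).drop r) ∧
      WordLT ((initialWord s m).drop r) ((initialWord s m).take ((initialWord s m).length - r))) ↔
      (∀ k < m - r, (∀ i < k, (s i).rev = s (i + r)) → (s k).rev ≤ s (k + r)) ∧
      ∃ k < m - r, (∀ i < k, s (i + r) = s i) ∧ s (k + r) < s k := by
    intro r hr
    rw [hl, take_initialWord (Nat.sub_le _ _), drop_initialWord, reflect_initialWord,
      wordLE_initialWord_iff, wordLT_initialWord_iff]
    rfl
  simp only [fundamentalWords, Set.mem_ofPred_eq]
  constructor
  · rintro (⟨_, h⟩ | ⟨_, d, h, _⟩) r h1 h2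
    · exact (key r h2).1 (h r h1 (by rwa [hl]))
    · have := congrArg List.length h
      rw [hl] at this
      simp at this
      omega
  · intro h
    left
    rw [hl]
    refine ⟨hm, fun r h1 h2 => ?_⟩
    have := (key r h2).2 (h r h1 h2)
    rwa [hl] at this

theorem length_pos_of_mem_fundamentalWords {a : List (Fin (M + 1))}
    (ha : a ∈ fundamentalWords M) : 0 < a.length := by
  rcases ha with ⟨h, _⟩ | ⟨_, d, rfl, _⟩
  · omega
  · simp

theorem exists_lt_of_mem_fundamentalWords {a : List (Fin (M + 1))} (ha : a ∈ fundamentalWords M)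
    {r : ℕ} (h1 : 1 ≤ r) (h2 : r < a.length) :
    ∃ k < a.length - r, (∀ i < k, periodicSeq a (i + r) = periodicSeq a i) ∧
      periodicSeq a (k + r) < periodicSeq a k := by
  rw [← initialWord_periodicSeq a] at ha
  exact ((initialWord_mem_fundamentalWords_iff (by omega)).1 ha r h1 h2).2

theorem rev_le_of_mem_fundamentalWords {a : List (Fin (M + 1))} (ha : a ∈ fundamentalWords M)
    {r : ℕ} (h1 : 1 ≤ r) (h2 : r < a.length) :
    ∀ k < a.length - r, (∀ i < k, (periodicSeq a i).rev = periodicSeq a (i + r)) →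
      (periodicSeq a k).rev ≤ periodicSeq a (k + r) := by
  rw [← initialWord_periodicSeq a] at ha
  exact ((initialWord_mem_fundamentalWords_iff (by omega)).1 ha r h1 h2).1

/-- The last letter, as a proper suffix, is smaller than the first one. Consequently the increment
in c⁺ never wraps around. -/
theorem last_lt_of_mem_fundamentalWords {a : List (Fin (M + 1))} (ha : a ∈ fundamentalWords M)
    {i : ℕ} (h : i + 1 = a.length) : a[i] < Fin.last M := by
  rcases Nat.eq_zero_or_pos i with rfl | hi
  · rcases ha with ⟨h', _⟩ | ⟨_, d, rfl, _, hd⟩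
    · omega
    · simpa using hd
  · obtain ⟨k, hk, _, hlt⟩ := exists_lt_of_mem_fundamentalWords ha hi (by omega)
    obtain rfl : k = 0 := by omega
    rw [zero_add, periodicSeq_apply_of_lt (by omega)] at hlt
    exact hlt.trans_le (Fin.le_last _)

theorem periodicSeq_add_mul_length (w : List (Fin (M + 1))) (i k : ℕ) :
    periodicSeq w (i + w.length * k) = periodicSeq w i := by
  simp [periodicSeq]

theorem rev_zero_lt_of_mem_fundamentalWords {a : List (Fin (M + 1))}
    (ha : a ∈ fundamentalWords M) (h : 1 < a.length) :
    (periodicSeq a 0).rev < periodicSeq a 0 := by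
  have h1 := rev_le_of_mem_fundamentalWords ha (r := a.length - 1) (by omega) (by omega) 0
    (by omega) (by simp)
  obtain ⟨k, hk, _, hlt⟩ :=
    exists_lt_of_mem_fundamentalWords ha (r := a.length - 1) (by omega) (by omega)
  obtain rfl : k = 0 := by omega
  exact h1.trans_lt hlt

theorem rev_zero_le_of_mem_fundamentalWords {a : List (Fin (M + 1))}
    (ha : a ∈ fundamentalWords M) : (periodicSeq a 0).rev ≤ periodicSeq a 0 := by
  rcases Nat.lt_or_ge 1 a.length with h | h
  · exact (rev_zero_lt_of_mem_fundamentalWords ha h).le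
  · rcases ha with ⟨h', _⟩ | ⟨_, d, rfl, hd, _⟩
    · omega
    · simpa [periodicSeq] using hd

/-- The periodic sequence of a fundamental word lies in `𝒱`. -/
theorem periodicSeq_mem_V {a : List (Fin (M + 1))} (ha : a ∈ fundamentalWords M) :
    periodicSeq a ∈ V M := by
  have hpos := length_pos_of_mem_fundamentalWords ha
  set m := a.length with hm
  set s := periodicSeq a with hs
  have hper : ∀ i, s (i + m) = s i := periodicSeq_add_length a
  intro n
  have hshift : shift n s = shift (n % m) s := by
    funext i
    have := periodicSeq_add_mul_length a (i + n % m) (n / m)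
    rw [add_assoc, Nat.mod_add_div] at this
    exact this
  have hr : n % m < m := Nat.mod_lt _ hpos
  rw [hshift]
  generalize n % m = r at hr
  rcases Nat.eq_zero_or_pos r with rfl | h1
  · refine ⟨?_, le_rfl⟩
    by_cases h2 : 1 < m
    · rw [toLex_le_iff]
      intro k hk
      have hlt : (s 0).rev < s 0 := rev_zero_lt_of_mem_fundamentalWords ha h2
      rcases Nat.eq_zero_or_pos k with rfl | hk0
      · exact hlt.le
      · exact absurd (hk 0 hk0) hlt.ne
    · have h3 : m = 1 := by omega
      have hconst : ∀ i, s i = s 0 := fun i => by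
        induction i with
        | zero => rfl
        | succ i ih => rw [← ih, ← hper i, h3]
      have h0 : (s 0).rev ≤ s 0 := rev_zero_le_of_mem_fundamentalWords ha
      rw [toLex_le_iff]
      intro k _
      simpa [reflectSeq, shift, hconst k] using h0
  · constructor
    · by_contra hcon
      obtain ⟨k, hk, hlt⟩ := (toLex_lt_iff _ _).1 (not_le.1 hcon)
      simp only [shift, reflectSeq] at hk hlt
      rcases Nat.lt_or_ge k (m - r) with hk1 | hk1
      · exact absurd (rev_le_of_mem_fundamentalWords ha h1 hr k hk1 fun i hi => (hk i hi).symm)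
          (not_le.2 hlt)
      -- Beyond its first m - r digits the tail reads `a` from the start. A violation there, once
      -- reflected, is a violation for the suffix starting at m - r; a first violation at k ≥ m is
      -- impossible by periodicity.
      · rcases Nat.lt_or_ge k m with hk2 | hk2
        · obtain ⟨q, rfl⟩ := Nat.exists_eq_add_of_le hk1
          have hq := rev_le_of_mem_fundamentalWords ha (r := m - r) (by omega) (by omega) q
            (by omega)
          have hw : ∀ i, s (m - r + i + r) = s i := fun i => by
            rw [← hper i]; congr 1; omega
          rw [hw] at hlt
          refine absurd (hq fun i hi => ?_) (not_le.2 ?_)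
          · have := hk (m - r + i) (by omega)
            rw [hw] at this
            change (s i).rev = s _
            rw [this, Fin.rev_rev, Nat.add_comm i]
          · change s _ < (s q).rev
            rw [Fin.lt_rev_iff, Nat.add_comm q]
            exact hlt
        · have := hk (k - m) (by omega)
          have e1 : s (k - m + r) = s (k + r) := by rw [← hper]; congr 1; omega
          have e2 : s (k - m) = s k := by rw [← hper]; congr 1; omega
          rw [e1, e2] at this
          exact absurd this hlt.ne
    · obtain ⟨k, _, h⟩ := exists_lt_of_mem_fundamentalWords ha h1 hr
      exact le_of_lt ((toLex_lt_iff _ _).2 ⟨k, h⟩)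

end Fundamental
-- Compositions are not irreducible
section Composition

variable {M : ℕ}

theorem exists_tail_of_mem_fundamentalWords_one {d : List (Fin (1 + 1))}
    (hd : d ∈ fundamentalWords 1) : ∃ d', d = 1 :: d' ∧ 0 ∈ d' := by
  have h2 : 2 ≤ d.length := by
    rcases hd with ⟨h, _⟩ | ⟨h, _⟩
    · exact h
    · omega
  obtain ⟨k, hk, _, hlt⟩ :=
    exists_lt_of_mem_fundamentalWords hd (r := d.length - 1) (by omega) (by omega)
  obtain rfl : k = 0 := by omega
  rw [zero_add, periodicSeq_apply_of_lt (by omega), periodicSeq_apply_of_lt (by omega)] at hlt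
  rcases d with _ | ⟨x, d⟩
  · simp at h2
  · simp only [List.length_cons] at h2
    rw [List.getElem_cons, dif_neg (by rw [List.length_cons]; omega), List.getElem_cons_zero] at hlt
    have hmem := List.getElem_mem (l := d) (n := (x :: d).length - 1 - 1) (by simp; omega)
    generalize d[(x :: d).length - 1 - 1]'(by simp; omega) = y at hlt hmem
    have hx : x = 1 := eq_one_of_lt hlt
    have hy : y = 0 := eq_zero_of_lt hlt
    subst hx hy
    exact ⟨d, rfl, hmem⟩

/-- Once the digit `0` is read, the blocks from the vertex `A` fall below `c̄c̄c̄⋯`. -/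
theorem exists_lt_of_pathOf_A {c : List (Fin (M + 1))} (hc : c ∈ fundamentalWords M)
    {d : List (Fin (1 + 1))} (hd : 0 ∈ d) (u : List (Fin (M + 1)))
    (hu : u = ((pathOf .A d).map (Edge.block c)).flatten) :
    ∃ k, ∃ h : k < u.length, (∀ i (hi : i < k), u[i] = periodicSeq (reflect c) i) ∧
      u[k] < periodicSeq (reflect c) k := by
  have hpos := length_pos_of_mem_fundamentalWords hc
  have hrl := length_reflect c
  induction d generalizing u with
  | nil => simp at hd
  | cons x d ih =>
    rcases eq_zero_or_one x with rfl | rfl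
    · simp only [pathOf, nextEdge, if_true, List.map_cons, List.flatten_cons, Edge.block] at hu
      have hl : (reflect (plus c)).length = c.length := by rw [length_reflect, length_plus]
      have hul : c.length ≤ u.length := by rw [hu, List.length_append, hl]; omega
      -- The block emitted by 0 at A is the reflection of c⁺, which differs from c̄ only in its last
      -- digit.
      refine ⟨c.length - 1, by omega, fun i hi => ?_, ?_⟩
      · subst hu
        rw [List.getElem_append_left (by omega), periodicSeq_apply_of_lt (by omega)]
        simp only [reflect, List.getElem_map]
        rw [getElem_plus_of_lt _ _ (by omega)]
      · subst hu
        rw [List.getElem_append_left (by omega), periodicSeq_apply_of_lt (by omega)]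
        simp only [reflect, List.getElem_map]
        rw [getElem_plus_last _ _ (by omega), Fin.rev_lt_rev]
        have hlast := last_lt_of_mem_fundamentalWords hc (i := c.length - 1) (by omega)
        rw [Fin.lt_def, Fin.val_add_one_of_lt hlast]
        omega
    · rw [List.mem_cons] at hd
      obtain ⟨k, hk, h1, h2⟩ := ih (hd.resolve_left (by simp)) _ rfl
      have hx : (1 : Fin (1 + 1)) ≠ 0 := by simp
      simp only [pathOf, nextEdge, hx, if_false, List.map_cons, List.flatten_cons, Edge.block,
        Edge.dst] at hu
      refine ⟨k + (reflect c).length, by rw [hu, List.length_append]; omega, fun i hi => ?_, ?_⟩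
      · subst hu
        rw [List.getElem_append]
        split_ifs with hic
        · rw [periodicSeq_apply_of_lt hic]
        · rw [h1 _ (by omega), ← periodicSeq_add_length, Nat.sub_add_cancel (by omega)]
      · subst hu
        rw [List.getElem_append_right (by omega), periodicSeq_add_length]
        simpa using h2

/-- The periodic sequence of a composition is not irreducible. -/
theorem not_isIrreducibleSeq_comp {c : List (Fin (M + 1))} (hc : c ∈ fundamentalWords M)
    {d : List (Fin (1 + 1))} (hd : d ∈ fundamentalWords 1) :
    ¬ IsIrreducibleSeq (periodicSeq (comp c d)) := by
  rintro ⟨-, h⟩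
  have hpos := length_pos_of_mem_fundamentalWords hc
  obtain ⟨d', rfl, hd'⟩ := exists_tail_of_mem_fundamentalWords_one hd
  set u := ((pathOf .A d').map (Edge.block c)).flatten with hu
  have hcomp : comp c (1 :: d') = plus c ++ u := by
    simp [comp, pathOf, nextEdge, Edge.block, Edge.dst, hu]
  have hpl := length_plus c
  have hprefix : ∀ i (hi : i < (plus c).length),
      periodicSeq (comp c (1 :: d')) i = (plus c)[i] := fun i hi => by
    rw [hcomp, periodicSeq_apply_of_lt (by rw [List.length_append]; omega),
      List.getElem_append_left hi]
  have hinit : initialWord (periodicSeq (comp c (1 :: d'))) (c.length - 1 + 1) = plus c := by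
    symm
    rw [eq_initialWord_iff]
    exact ⟨by omega, fun i hi => (hprefix i hi).symm⟩
  have hlast := last_lt_of_mem_fundamentalWords hc (i := c.length - 1) (by omega)
  -- The offending prefix is c⁺, and lowering its last digit gives back c.
  have := h (c.length - 1) (by
    rw [hprefix _ (by omega), getElem_plus_last _ _ (by omega), Fin.lt_def,
      Fin.val_add_one_of_lt hlast]
    simp) (by rw [hinit, minus_plus]; exact periodicSeq_mem_V hc)
  rw [hinit, plus_reflect_plus] at this
  refine lt_asymm this ?_
  obtain ⟨k, hk, h1, h2⟩ := exists_lt_of_pathOf_A hc hd' u hu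
  have hval : ∀ i (hi : i < u.length),
      periodicSeq (comp c (1 :: d')) (i + (plus c).length) = u[i] := fun i hi => by
    rw [hcomp, periodicSeq_apply_of_lt (by rw [List.length_append]; omega),
      List.getElem_append_right (by omega)]
    simp
  refine (toLex_lt_iff _ _).2 ⟨k + (plus c).length, fun i hi => ?_, ?_⟩
  · unfold appendSeq
    split_ifs with hi'
    · exact hprefix i hi'
    · rw [← h1 (i - (plus c).length) (by omega), ← hval, Nat.sub_add_cancel (by omega)]
  · unfold appendSeq
    rw [dif_neg (by omega), hval _ hk, Nat.add_sub_cancel]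
    exact h2

end Composition
-- Decomposing a reducible periodic sequence into blocks
section Desubstitution

variable {M : ℕ}

/-- The reflection if `u = 1`, the identity if `u = 0`. -/
def twist (u : Fin (1 + 1)) (x : Fin (M + 1)) : Fin (M + 1) := if u = 1 then x.rev else x

theorem twist_zero (x : Fin (M + 1)) : twist 0 x = x := rfl

theorem twist_one (x : Fin (M + 1)) : twist 1 x = x.rev := rfl

theorem twist_twist (u : Fin (1 + 1)) (x : Fin (M + 1)) : twist u (twist u x) = x := by
  fin_cases u <;> simp [twist]

theorem twist_rev (u : Fin (1 + 1)) (x : Fin (M + 1)) : twist u.rev x = (twist u x).rev := by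
  fin_cases u <;> simp [twist]

theorem twist_injective (u : Fin (1 + 1)) : Function.Injective (twist u : Fin (M + 1) → _) :=
  fun x y h => by rw [← twist_twist u x, h, twist_twist]

/-- The digits of the blocks, for the state `u` before the block (`0` for `B` and `Start`, `1` for
`A`) and the state `v` after it: `p` begins with the word `c` and `s` begins with `c⁺`. -/
def blockDigit (s p : ℕ → Fin (M + 1)) (u v : Fin (1 + 1)) (i : ℕ) : Fin (M + 1) :=
  twist u (if u = v then p i else s i)

theorem blockDigit_rev (s p : ℕ → Fin (M + 1)) (u v : Fin (1 + 1)) (i : ℕ) :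
    blockDigit s p u.rev v.rev i = (blockDigit s p u v i).rev := by
  simp only [blockDigit, twist_rev, Fin.rev_inj]

/-- The sequence `s` in `𝒱` begins with `c⁺` and is at most `c⁺c̄c̄c̄⋯`, where `c` is a word of
length `q + 1` with `p = c^∞` in `𝒱`. -/
structure IsRenormalizable (s p : ℕ → Fin (M + 1)) (q : ℕ) : Prop where
  mem_V : s ∈ V M
  mem_V' : p ∈ V M
  periodic : ∀ i, p (i + (q + 1)) = p i
  eq_of_lt : ∀ i < q, s i = p i
  last : (p q).val + 1 = (s q).val
  le : toLex (shift (q + 1) s) ≤ toLex (reflectSeq p)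

/-- The successive states of the path whose blocks spell `s`. -/
def stateSeq (s p : ℕ → Fin (M + 1)) (q : ℕ) : ℕ → Fin (1 + 1)
  | 0 => 0
  | k + 1 => if s (q + k * (q + 1)) = twist (stateSeq s p q k) (p q) then stateSeq s p q k
      else (stateSeq s p q k).rev

namespace IsRenormalizable

variable {s p : ℕ → Fin (M + 1)} {q : ℕ}

theorem last_lt (h : IsRenormalizable s p q) : p q < s q := by
  rw [Fin.lt_def, ← h.last]; omega

theorem toLex_le (h : IsRenormalizable s p q) : toLex p ≤ toLex s :=
  le_of_lt ((toLex_lt_iff _ _).2 ⟨q, fun i hi => (h.eq_of_lt i hi).symm, h.last_lt⟩)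

/-- The bounds agree on the first q digits and differ by one at digit q, so t starts with c or c⁺.
After c the lower bound p is cancelled by its own period. After c⁺ the upper bound leaves the tail
of s, which is at most the reflection of p, so the reflected remainder is at least p. -/
theorem first_block (h : IsRenormalizable s p q) {t : ℕ → Fin (M + 1)} (h1 : toLex p ≤ toLex t)
    (h2 : toLex t ≤ toLex s) :
    (∀ i < q, t i = p i) ∧ (t q = p q ∧ toLex p ≤ toLex (shift (q + 1) t) ∨
      t q = s q ∧ toLex p ≤ toLex (reflectSeq (shift (q + 1) t))) := by
  have ht := eq_of_toLex_le_of_le h1 h2 fun i hi => (h.eq_of_lt i hi).symm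
  have hq1 := (toLex_le_iff _ _).1 h1 q fun i hi => (ht i hi).symm
  have hq2 := (toLex_le_iff _ _).1 h2 q fun i hi => (ht i hi).trans (h.eq_of_lt i hi).symm
  refine ⟨ht, ?_⟩
  have hl := h.last
  rw [Fin.le_def] at hq1 hq2
  rcases (show (t q).val = (p q).val ∨ (t q).val = (s q).val by omega) with h' | h'
  · left
    refine ⟨Fin.ext h', ?_⟩
    have := toLex_drop_le (q + 1) h1 fun i hi => by
      rcases Nat.lt_succ_iff_lt_or_eq.1 hi with hi | rfl
      · exact (ht i hi).symm
      · exact (Fin.ext h').symm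
    simp only [h.periodic] at this
    exact this
  · right
    refine ⟨Fin.ext h', toLex_le_reflectSeq_comm.1 ?_⟩
    have := toLex_drop_le (q + 1) h2 fun i hi => by
      rcases Nat.lt_succ_iff_lt_or_eq.1 hi with hi | rfl
      · exact (ht i hi).trans (h.eq_of_lt i hi).symm
      · exact Fin.ext h'
    exact this.trans h.le

theorem twist_shift_le (h : IsRenormalizable s p q) (u : Fin (1 + 1)) (n : ℕ) :
    toLex (fun i => twist u (shift n s i)) ≤ toLex s := by
  rcases eq_zero_or_one u with rfl | rfl
  · exact (h.mem_V n).2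
  · exact toLex_reflectSeq_le_comm.1 (h.mem_V n).1

/-- The invariant of the block decomposition: `first_block` carries the lower bound across each
block, and the state flips exactly when the block is c⁺ or its reflection. The upper bound always
holds, by `twist_shift_le`. -/
theorem toLex_le_twist_shift (h : IsRenormalizable s p q) (k : ℕ) :
    toLex p ≤ toLex (fun i => twist (stateSeq s p q k) (shift (k * (q + 1)) s i)) := by
  induction k with
  | zero => simpa [stateSeq, twist_zero, shift] using h.toLex_le
  | succ k ih =>
    have hs : ∀ i, s (i + (k + 1) * (q + 1)) = s (i + (q + 1) + k * (q + 1)) := fun i => by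
      congr 1; ring
    rcases (h.first_block ih (h.twist_shift_le _ _)).2 with ⟨hq, hle⟩ | ⟨hq, hle⟩
    · have : s (q + k * (q + 1)) = twist (stateSeq s p q k) (p q) := by
        rw [← hq, twist_twist]; rfl
      simp only [stateSeq, this, if_true, shift, hs]
      exact hle
    · have : s (q + k * (q + 1)) ≠ twist (stateSeq s p q k) (p q) := by
        intro hcon
        simp only [shift, hcon, twist_twist] at hq
        exact h.last_lt.ne hq
      simp only [stateSeq, this, if_false, shift, hs, twist_rev]
      exact hle

/-- The sequence `s` is spelled by blocks. -/
theorem apply_eq_blockDigit (h : IsRenormalizable s p q) (k i : ℕ) (hi : i < q + 1) :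
    s (i + k * (q + 1)) = blockDigit s p (stateSeq s p q k) (stateSeq s p q (k + 1)) i := by
  obtain ⟨h1, h2⟩ := h.first_block (h.toLex_le_twist_shift k) (h.twist_shift_le _ _)
  apply twist_injective (stateSeq s p q k)
  rw [blockDigit, twist_twist]
  rcases Nat.lt_succ_iff_lt_or_eq.1 hi with hi | rfl
  · rw [h.eq_of_lt i hi, ite_self]
    exact h1 i hi
  · by_cases hc : s (i + k * (i + 1)) = twist (stateSeq s p i k) (p i)
    · simp only [stateSeq, hc, if_true, twist_twist]
    · have hne : stateSeq s p i k ≠ (stateSeq s p i k).rev := by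
        generalize stateSeq s p i k = u
        fin_cases u <;> simp
      simp only [stateSeq, hc, if_false, hne]
      rcases h2 with ⟨h2, _⟩ | ⟨h2, _⟩
      · exact absurd (by rw [← h2, twist_twist]; rfl) hc
      · exact h2

theorem stateSeq_one (h : IsRenormalizable s p q) : stateSeq s p q 1 = 1 := by
  have : s q ≠ p q := h.last_lt.ne'
  simp [stateSeq, twist_zero, this]

/-- Away from the last digit, blocks depend only on the state before them. -/
theorem blockDigit_of_lt (h : IsRenormalizable s p q) (u v : Fin (1 + 1)) {i : ℕ} (hi : i < q) :
    blockDigit s p u v i = twist u (p i) := by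
  rw [blockDigit, h.eq_of_lt i hi, ite_self]

/-- A proper suffix of `c⁺` is not the reflection of a prefix of `c`. -/
theorem rev_prefix_ne (h : IsRenormalizable s p q) {r : ℕ} (hr : r ≤ q) :
    ¬ ∀ i < q + 1 - r, s (i + r) = (p i).rev := by
  intro hall
  -- The suffix of c would be one less in its last digit than a reflected prefix of c, against p ∈
  -- 𝒱.
  have h1 := (toLex_le_iff _ _).1 (h.mem_V' r).1 (q - r) fun i hi => by
    simp only [reflectSeq, shift]
    rw [← h.eq_of_lt (i + r) (by omega), hall i (by omega)]
  have h2 := hall (q - r) (by omega)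
  simp only [reflectSeq, shift] at h1
  rw [Nat.sub_add_cancel hr] at h1 h2
  rw [← h2] at h1
  exact absurd h1 (not_le.2 h.last_lt)

/-- A proper suffix of `c` is not a prefix of `c`. -/
theorem prefix_ne (h : IsRenormalizable s p q) {r : ℕ} (hr : r ≤ q) (hr0 : 1 ≤ r) :
    ¬ ∀ i < q + 1 - r, p (i + r) = p i := by
  intro hall
  -- The same suffix of c⁺ would exceed a prefix of s, against s ∈ 𝒱.
  have h1 := (toLex_le_iff _ _).1 (h.mem_V r).2 (q - r) fun i hi => by
    simp only [shift]
    rw [h.eq_of_lt (i + r) (by omega), hall i (by omega), h.eq_of_lt i (by omega)]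
  have h2 := hall (q - r) (by omega)
  simp only [shift] at h1
  rw [Nat.sub_add_cancel hr] at h1 h2
  rw [h.eq_of_lt (q - r) (by omega), ← h2] at h1
  exact absurd h1 (not_le.2 h.last_lt)

theorem rev_self_ne (h : IsRenormalizable s p q) : ¬ ∀ i < q + 1, s i = (s i).rev := by
  intro hall
  have h1 := (toLex_le_iff _ _).1 (h.mem_V' 0).1 q fun i hi => by
    simp only [reflectSeq, shift]
    rw [add_zero, ← h.eq_of_lt i hi]
    exact (hall i (by omega)).symm
  have h2 := hall q (by omega)
  simp only [reflectSeq, shift, add_zero] at h1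
  have h3 := Fin.rev_lt_rev.2 h.last_lt
  rw [← h2] at h3
  exact absurd (h3.trans_le h1) (not_lt.2 h.last_lt.le)

/-- Every period of `s` is a multiple of the length of the blocks. -/
theorem dvd_of_periodic (h : IsRenormalizable s p q) {m : ℕ} (hm : ∀ i, s (i + m) = s i) :
    q + 1 ∣ m := by
  by_contra hdvd
  set k := m / (q + 1) with hk
  set r := m % (q + 1) with hr
  have hr0 : 1 ≤ r := Nat.one_le_iff_ne_zero.2 fun h0 => hdvd (Nat.dvd_of_mod_eq_zero h0)
  have hrq : r < q + 1 := Nat.mod_lt _ (Nat.succ_pos q)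
  have hmk : m = r + k * (q + 1) := by rw [mul_comm]; exact (Nat.mod_add_div m (q + 1)).symm
  -- If the period m falls r digits into block k, the copy of s starting there has its first block
  -- cut in two: `h1` matches its beginning with the end of block k, and `h2` matches its end with
  -- the beginning of block k + 1. Each choice of states gives a forbidden overlap.
  have h1 : ∀ i < q + 1 - r,
      p i = blockDigit s p (stateSeq s p q k) (stateSeq s p q (k + 1)) (i + r) := fun i hi => by
    rw [← h.apply_eq_blockDigit _ _ (by omega), ← h.eq_of_lt i (by omega), ← hm i, hmk, add_assoc]
  have h2 : ∀ i < r, s (i + (q + 1 - r)) = twist (stateSeq s p q (k + 1)) (p i) := fun i hi => by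
    rw [← h.blockDigit_of_lt _ (stateSeq s p q (k + 1 + 1)) (by omega),
      ← h.apply_eq_blockDigit _ _ (by omega), ← hm, hmk]
    congr 1
    rw [add_mul]
    omega
  rcases (eq_zero_or_one (stateSeq s p q (k + 1))).symm with hv | hv
  · rw [hv] at h2
    exact h.rev_prefix_ne (r := q + 1 - r) (by omega) fun i hi => h2 i (by omega)
  · rw [hv] at h1
    rcases (eq_zero_or_one (stateSeq s p q k)).symm with hu | hu
    · rw [hu] at h1
      refine h.rev_prefix_ne (r := r) (by omega) fun i hi => ?_
      rw [h1 i hi]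
      simp [blockDigit, twist_one]
    · rw [hu] at h1
      refine h.prefix_ne (r := r) (by omega) hr0 fun i hi => ?_
      rw [h1 i hi]
      simp [blockDigit, twist_zero]

/-- Blocks read from A are c̄ or the reflection of c⁺, and neither can equal the first block c⁺ of
s. -/
theorem stateSeq_period (h : IsRenormalizable s p q) {l : ℕ}
    (hl : ∀ i, s (i + l * (q + 1)) = s i) : stateSeq s p q l = 0 := by
  by_contra hu
  have hu := (eq_zero_or_one _).resolve_left hu
  have h1 : ∀ i < q + 1, s i = blockDigit s p 1 (stateSeq s p q (l + 1)) i := fun i hi => by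
    rw [← hu, ← h.apply_eq_blockDigit l i hi, hl]
  rcases (eq_zero_or_one (stateSeq s p q (l + 1))).symm with hv | hv
  · rw [hv] at h1
    exact h.rev_prefix_ne (r := 0) (by omega) fun i hi => h1 i hi
  · rw [hv] at h1
    exact h.rev_self_ne fun i hi => h1 i hi

theorem stateSeq_add_period (h : IsRenormalizable s p q) {l : ℕ}
    (hl : ∀ i, s (i + l * (q + 1)) = s i) (k : ℕ) :
    stateSeq s p q (k + l) = stateSeq s p q k := by
  induction k with
  | zero => rw [zero_add, h.stateSeq_period hl]; rfl
  | succ k ih =>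
    have : s (q + (k + l) * (q + 1)) = s (q + k * (q + 1)) := by
      rw [← hl (q + k * (q + 1))]; congr 1; ring
    rw [Nat.add_right_comm]
    simp only [stateSeq, ih, this]

/-- The sequence spelled by blocks depends monotonically on the states. -/
theorem lt_of_states_lt (h : IsRenormalizable s p q) {F G : ℕ → Fin (1 + 1)}
    {x y : ℕ → Fin (M + 1)}
    (hx : ∀ k, ∀ i < q + 1, x (i + k * (q + 1)) = blockDigit s p (F k) (F (k + 1)) i)
    (hy : ∀ k, ∀ i < q + 1, y (i + k * (q + 1)) = blockDigit s p (G k) (G (k + 1)) i)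
    (h0 : F 0 = G 0) (hlt : toLex (shift 1 F) < toLex (shift 1 G)) : toLex x < toLex y := by
  obtain ⟨k, hk, hlt⟩ := (toLex_lt_iff _ _).1 hlt
  simp only [shift] at hk hlt
  have hFG : ∀ i ≤ k, F i = G i := fun i hi => by
    rcases i with _ | i
    · exact h0
    · exact hk i hi
  -- At the first different transition the common state leads to 0 and to 1 respectively. The blocks
  -- are c and c⁺ from state 0, or the reflection of c⁺ and c̄ from state 1; either pair first
  -- differs, increasingly, at the last digit.
  refine (toLex_lt_iff _ _).2 ⟨q + k * (q + 1), fun i hi => ?_, ?_⟩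
  · have hdm := Nat.mod_add_div i (q + 1)
    have hmod : i % (q + 1) < q + 1 := Nat.mod_lt i (Nat.succ_pos q)
    have hdk : i / (q + 1) ≤ k := by
      rw [← Nat.lt_succ_iff, Nat.div_lt_iff_lt_mul (by omega), Nat.succ_eq_add_one, add_mul k 1]
      omega
    rw [← hdm, mul_comm (q + 1), hx _ _ hmod, hy _ _ hmod, hFG _ hdk]
    rcases hdk.lt_or_eq with hdk | hdk
    · rw [hFG _ hdk]
    · rw [h.blockDigit_of_lt _ _ (by rw [mul_comm, hdk] at hdm; omega),
        h.blockDigit_of_lt _ _ (by rw [mul_comm, hdk] at hdm; omega)]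
  · rw [hx _ _ (by omega), hy _ _ (by omega), hFG k le_rfl]
    have hF := eq_zero_of_lt hlt
    have hG := eq_one_of_lt hlt
    rw [hF, hG]
    rcases eq_zero_or_one (G k) with hu | hu <;> rw [hu]
    · simpa [blockDigit, twist_zero] using h.last_lt
    · simpa [blockDigit, twist_one] using h.last_lt

end IsRenormalizable

/-- If a sequence of binary digits exceeds another one that contains the digit `0`, it still does
after a digit `1` is put before it. -/
theorem toLex_lt_cons_one {x y : ℕ → Fin (1 + 1)} (hy : ∃ i, y i = 0) (h0 : x 0 = 1)
    (hlt : toLex y < toLex (shift 1 x)) : toLex y < toLex x := by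
  obtain ⟨k, hk, hlt⟩ := (toLex_lt_iff _ _).1 hlt
  simp only [shift] at hk hlt
  -- If y begins with exactly z ones, the tail of x above y also begins with z ones, so x begins
  -- with z + 1 and exceeds y at its first 0.
  have hz := Nat.find_spec hy
  have hmin : ∀ i < Nat.find hy, y i = 1 := fun i hi => by
    exact (eq_zero_or_one _).resolve_left (Nat.find_min hy hi)
  have hle : Nat.find hy ≤ k := Nat.find_min' hy (eq_zero_of_lt hlt)
  have hx : ∀ i ≤ Nat.find hy, x i = 1 := fun i hi => by
    rcases i with _ | i
    · exact h0
    · rw [← hk i (by omega), hmin i (by omega)]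
  refine (toLex_lt_iff _ _).2 ⟨Nat.find hy, fun i hi => ?_, ?_⟩
  · rw [hmin i hi, hx i hi.le]
  · rw [hz, hx _ le_rfl]
    simp

/-- Spelled sequences can be compared with s only from state 0. The bound after a digit 1 follows
from the bound one position earlier, since prefixing 1 to a tail above y would keep it above y. -/
theorem toLex_shift_le_of_states {x y : ℕ → Fin (1 + 1)} (hy : ∃ i, y i = 0)
    (hx : ∀ n, x n = 0 → toLex (shift (n + 1) x) ≤ toLex y)
    (hx0 : x 0 = 1 → toLex (shift 1 x) ≤ toLex y) (n : ℕ) :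
    toLex (shift (n + 1) x) ≤ toLex y := by
  induction n with
  | zero =>
    rcases eq_zero_or_one (x 0) with h | h
    · exact hx 0 h
    · exact hx0 h
  | succ n ih =>
    rcases eq_zero_or_one (x (n + 1)) with h | h
    · exact hx _ h
    · rw [← not_lt] at ih ⊢
      refine fun hlt => ih (toLex_lt_cons_one hy (by simpa [shift] using h) ?_)
      rwa [shift_one_shift]

/-! ### The words c and d are fundamental -/

namespace IsRenormalizable

variable {s p : ℕ → Fin (M + 1)} {q l : ℕ}

theorem exists_stateSeq_eq_zero (h : IsRenormalizable s p q) (hl0 : 0 < l)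
    (hl : ∀ i, s (i + l * (q + 1)) = s i) : ∃ i, shift 1 (stateSeq s p q) i = 0 :=
  ⟨l - 1, by simp only [shift]; rw [Nat.sub_add_cancel hl0, h.stateSeq_period hl]⟩

theorem states_shift_le (h : IsRenormalizable s p q) (hl0 : 0 < l)
    (hl : ∀ i, s (i + l * (q + 1)) = s i) (n : ℕ) :
    toLex (shift (n + 1) (stateSeq s p q)) ≤ toLex (shift 1 (stateSeq s p q)) := by
  refine toLex_shift_le_of_states (h.exists_stateSeq_eq_zero hl0 hl) (fun n hn => ?_)
    (fun _ => le_rfl) n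
  refine not_lt.1 fun hlt => not_lt.2 (h.mem_V (n * (q + 1))).2 ?_
  refine h.lt_of_states_lt (F := stateSeq s p q) (G := shift n (stateSeq s p q))
    h.apply_eq_blockDigit (fun k i hi => ?_) ?_ ?_
  · simp only [shift]
    rw [show k + 1 + n = k + n + 1 by omega, ← h.apply_eq_blockDigit _ _ hi]
    congr 1; ring
  · simpa [shift, stateSeq] using hn.symm
  · rwa [shift_one_shift]

/-- Reflecting the states reflects the spelled sequence, so the lower bound in 𝒱 becomes an upper
bound on reflected states. The first reflected tail starts with 0, which settles the base case. -/
theorem reflect_states_shift_le (h : IsRenormalizable s p q) (hl0 : 0 < l)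
    (hl : ∀ i, s (i + l * (q + 1)) = s i) (n : ℕ) :
    toLex (reflectSeq (shift 1 (stateSeq s p q))) ≤ toLex (shift (n + 1) (stateSeq s p q)) := by
  rw [toLex_reflectSeq_le_comm]
  refine toLex_shift_le_of_states (x := reflectSeq (stateSeq s p q))
    (h.exists_stateSeq_eq_zero hl0 hl) (fun n hn => ?_) (fun _ => ?_) n
  · refine not_lt.1 fun hlt => not_lt.2 (toLex_reflectSeq_le_comm.1 (h.mem_V (n * (q + 1))).1) ?_
    refine h.lt_of_states_lt (F := stateSeq s p q) (G := shift n (reflectSeq (stateSeq s p q)))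
      h.apply_eq_blockDigit (fun k i hi => ?_) ?_ ?_
    · simp only [shift, reflectSeq]
      rw [show k + 1 + n = k + n + 1 by omega, blockDigit_rev, ← h.apply_eq_blockDigit _ _ hi]
      congr 2; ring
    · simpa [shift, stateSeq] using hn.symm
    · rwa [shift_one_shift]
  · refine le_of_lt ((toLex_lt_iff _ _).2 ⟨0, by simp, ?_⟩)
    simp [shift, reflectSeq, h.stateSeq_one]

/-- The weak inequalities come from the order on states. Strictness uses minimality of the period of
s: a proper suffix of d equal to a prefix would give a shorter period. -/
theorem initialWord_states_mem (h : IsRenormalizable s p q) (hl0 : 0 < l)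
    (hl : ∀ i, s (i + l * (q + 1)) = s i)
    (hmin : ∀ n, 0 < n → n < l * (q + 1) → shift n s ≠ s) :
    initialWord (shift 1 (stateSeq s p q)) l ∈ fundamentalWords 1 := by
  set e := shift 1 (stateSeq s p q) with he
  have hper : ∀ k, e (k + l) = e k := fun k => by
    simp only [he, shift]
    rw [Nat.add_right_comm, h.stateSeq_add_period hl]
  have hshift : ∀ r, shift r e = shift (r + 1) (stateSeq s p q) := fun r => by
    funext i
    simp only [he, shift]
    congr 1
  have hl2 : 2 ≤ l := by
    by_contra hcon
    obtain rfl : l = 1 := by omega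
    have := h.stateSeq_period hl
    rw [h.stateSeq_one] at this
    simp at this
  rw [initialWord_mem_fundamentalWords_iff hl2]
  intro r hr1 hrl
  refine ⟨fun k _ hk => ?_, ?_⟩
  · have := h.reflect_states_shift_le hl0 hl r
    rw [← hshift] at this
    exact (toLex_le_iff _ _).1 this k hk
  · have h1 := h.states_shift_le hl0 hl r
    rw [← hshift] at h1
    have hne : ∃ i < l - r, e (i + r) ≠ e i := by
      by_contra! hall
      -- Cancelling the matched prefix leaves e itself on the left, by periodicity, so e is at most
      -- its shift by l - r. The opposite inequality is known, hence l - r is a period of the states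
      -- and (l - r)(q + 1) one of s.
      have h2 := toLex_drop_le (l - r) h1 (fun i hi => hall i hi)
      have h3 : (fun i => shift r e (i + (l - r))) = e := by
        funext i
        rw [← hper i]
        simp only [shift]
        congr 1; omega
      rw [h3] at h2
      have h4 := h.states_shift_le hl0 hl (l - r)
      rw [← hshift] at h4
      have h5 : e = shift (l - r) e := toLex.injective (le_antisymm h2 h4)
      have h6 : stateSeq s p q (l - r) = 0 := by
        have := congrFun h5 (l - 1)
        simp only [he, shift] at this
        rw [show l - 1 + 1 = l by omega, h.stateSeq_period hl,
          show l - 1 + (l - r) + 1 = l - r + l by omega, h.stateSeq_add_period hl] at this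
        exact this.symm
      have h7 : ∀ k, stateSeq s p q (k + (l - r)) = stateSeq s p q k := fun k => by
        rcases k with _ | k
        · rw [zero_add, h6]; rfl
        · have := congrFun h5 k
          simp only [he, shift] at this
          rw [this, Nat.add_right_comm]
      refine hmin ((l - r) * (q + 1)) (Nat.mul_pos (by omega) (by omega))
        (Nat.mul_lt_mul_of_pos_right (by omega) (by omega)) ?_
      funext i
      have hmod := Nat.mod_lt i (Nat.succ_pos q)
      have hi : i = i % (q + 1) + i / (q + 1) * (q + 1) := by
        rw [mul_comm]; exact (Nat.mod_add_div i (q + 1)).symm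
      simp only [shift]
      rw [hi, add_assoc, ← add_mul, h.apply_eq_blockDigit _ _ hmod, h.apply_eq_blockDigit _ _ hmod,
        Nat.add_right_comm, h7, h7]
    have hk := Nat.find_spec hne
    have hbefore : ∀ i < Nat.find hne, e (i + r) = e i := fun i hi => by
      by_contra hcon
      exact Nat.find_min hne hi ⟨hi.trans hk.1, hcon⟩
    exact ⟨Nat.find hne, hk.1, hbefore,
      lt_of_le_of_ne ((toLex_le_iff _ _).1 h1 _ hbefore) hk.2⟩

/-- The inequalities come from p ∈ 𝒱, strictness from `prefix_ne`. For a single letter, p 0 is at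
least its reflection and p 0 + 1 is still a digit, which forces M ≥ 2. -/
theorem initialWord_mem (h : IsRenormalizable s p q) :
    initialWord p (q + 1) ∈ fundamentalWords M := by
  rcases Nat.eq_zero_or_pos q with rfl | hq
  · have h1 := (toLex_le_iff _ _).1 (h.mem_V' 0).1 0 (by simp)
    have h2 := h.last
    simp only [reflectSeq, shift, add_zero] at h1
    have h3 := (s 0).isLt
    refine Or.inr ⟨?_, p 0, ?_, h1, ?_⟩
    · rw [Fin.le_def, Fin.val_rev] at h1
      omega
    · simp [initialWord]
    · rw [Fin.lt_def, Fin.val_last]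
      omega
  · rw [initialWord_mem_fundamentalWords_iff (by omega)]
    intro r hr1 hrq
    refine ⟨fun k _ => (toLex_le_iff _ _).1 (h.mem_V' r).1 k, ?_⟩
    have hne : ∃ i, i < q + 1 - r ∧ p (i + r) ≠ p i := by
      have := h.prefix_ne (r := r) (by omega) hr1
      push Not at this
      exact this
    have hk := Nat.find_spec hne
    have hbefore : ∀ i < Nat.find hne, p (i + r) = p i := fun i hi => by
      by_contra hcon
      exact Nat.find_min hne hi ⟨hi.trans hk.1, hcon⟩
    exact ⟨Nat.find hne, hk.1, hbefore,
      lt_of_le_of_ne ((toLex_le_iff _ _).1 (h.mem_V' r).2 _ hbefore) hk.2⟩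

theorem plus_initialWord (h : IsRenormalizable s p q) :
    plus (initialWord p (q + 1)) = initialWord s (q + 1) := by
  have hl := length_initialWord p (q + 1)
  rw [eq_initialWord_iff]
  refine ⟨by rw [length_plus, hl], fun i hi => ?_⟩
  rw [length_plus, hl] at hi
  rcases Nat.lt_succ_iff_lt_or_eq.1 hi with hi | rfl
  · rw [getElem_plus_of_lt _ _ (by omega), getElem_initialWord, h.eq_of_lt i hi]
  · rw [getElem_plus_last _ _ (by omega), getElem_initialWord]
    have h2 := h.last
    have h3 := (s i).isLt
    ext
    rw [Fin.val_add_one_of_lt, h2]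
    rw [Fin.lt_def, Fin.val_last]
    omega

/-- The blocks along the path that reads the states `F` spell the sequence with these states. -/
theorem flatten_pathOf (h : IsRenormalizable s p q) (n : ℕ) (v : Vertex)
    (F : ℕ → Fin (1 + 1)) (x : ℕ → Fin (M + 1))
    (hv : v = .A ∧ F 0 = 1 ∨ v = .B ∧ F 0 = 0 ∨ v = .start ∧ F 0 = 0 ∧ F 1 = 1)
    (hx : ∀ k, ∀ i < q + 1, x (i + k * (q + 1)) = blockDigit s p (F k) (F (k + 1)) i) :
    ((pathOf v (initialWord (shift 1 F) n)).map (Edge.block (initialWord p (q + 1)))).flatten =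
      initialWord x (n * (q + 1)) := by
  induction n generalizing v F x with
  | zero => simp [initialWord, pathOf]
  | succ n ih =>
    have h1 : initialWord (shift 1 F) (n + 1) = F 1 :: initialWord (shift 1 (shift 1 F)) n := by
      rw [Nat.add_comm n 1, initialWord_add]
      simp [initialWord, shift]
    have h2 : (n + 1) * (q + 1) = (q + 1) + n * (q + 1) := by ring
    have h3 : initialWord x (q + 1) = initialWord (blockDigit s p (F 0) (F 1)) (q + 1) :=
      initialWord_congr.2 fun i hi => by simpa using hx 0 i hi
    rw [h1, h2, initialWord_add x, pathOf, List.map_cons, List.flatten_cons]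
    congr 1
    · rw [h3]
      have hb : ∀ u v, blockDigit s p u v = fun i => twist u (if u = v then p i else s i) :=
        fun u v => rfl
      -- Start shares state 0 with B; there F 1 = 1 makes its only block, c⁺, the one that B would
      -- emit.
      rcases eq_zero_or_one (F 1) with hF | hF <;>
      rcases hv with ⟨rfl, h0⟩ | ⟨rfl, h0⟩ | ⟨rfl, h0, h0'⟩ <;>
        simp [hF, h0, nextEdge, Edge.block, h.plus_initialWord, reflect_initialWord, hb, twist] <;>
        simp_all <;> rfl
    · apply ih
      · rcases eq_zero_or_one (F 1) with hF | hF <;>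
        rcases hv with ⟨rfl, h0⟩ | ⟨rfl, h0⟩ | ⟨rfl, h0, h0'⟩ <;>
          simp_all [nextEdge, Edge.dst, shift]
      · intro k i hi
        simp only [shift]
        rw [← hx _ _ hi]
        congr 1; ring

end IsRenormalizable

/-- If a prefix violates the irreducibility of `a^∞`, then `a` is a composition. -/
theorem exists_eq_comp {a : List (Fin (M + 1))} (ha : a ∈ fundamentalWords M)
    {p : ℕ → Fin (M + 1)} {q : ℕ} (h : IsRenormalizable (periodicSeq a) p q) :
    ∃ c ∈ fundamentalWords M, ∃ d ∈ fundamentalWords 1, a = comp c d := by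
  have hpos := length_pos_of_mem_fundamentalWords ha
  obtain ⟨l, hl⟩ := h.dvd_of_periodic (periodicSeq_add_length a)
  rw [mul_comm] at hl
  have hper : ∀ i, periodicSeq a (i + l * (q + 1)) = periodicSeq a i := by
    rw [← hl]; exact periodicSeq_add_length a
  have hl0 : 0 < l := by
    rcases Nat.eq_zero_or_pos l with rfl | h0
    · omega
    · exact h0
  refine ⟨initialWord p (q + 1), h.initialWord_mem, _,
    h.initialWord_states_mem hl0 hper fun n h1 h2 heq => ?_, ?_⟩
  -- Every proper suffix of `a` is strictly below the corresponding prefix, so no shorter shift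
  -- fixes a^∞.
  · obtain ⟨k, _, _, hlt⟩ := exists_lt_of_mem_fundamentalWords ha h1 (by omega)
    exact hlt.ne (congrFun heq k)
  · rw [comp, h.flatten_pathOf l .start _ (periodicSeq a)
      (Or.inr (Or.inr ⟨rfl, rfl, h.stateSeq_one⟩)) h.apply_eq_blockDigit, ← hl,
      initialWord_periodicSeq]

theorem isRenormalizable_of_le {s : ℕ → Fin (M + 1)} {q : ℕ} (hs : s ∈ V M) (h0 : 0 < s q)
    (hV : periodicSeq (minus (initialWord s (q + 1))) ∈ V M)
    (hle : toLex s ≤ toLex (appendSeq (initialWord s (q + 1))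
      (periodicSeq (plus (reflect (initialWord s (q + 1))))))) :
    IsRenormalizable s (periodicSeq (minus (initialWord s (q + 1)))) q := by
  have hil := length_initialWord s (q + 1)
  have hml : (minus (initialWord s (q + 1))).length = q + 1 := by rw [length_minus, hil]
  refine ⟨hs, hV, fun i => ?_, fun i hi => ?_, ?_, ?_⟩
  · have := periodicSeq_add_length (minus (initialWord s (q + 1))) i
    rwa [hml] at this
  · rw [periodicSeq_apply_of_lt (by omega), getElem_minus_of_lt _ _ (by omega),
      getElem_initialWord]
  · rw [periodicSeq_apply_of_lt (by omega), getElem_minus_last _ _ (by omega),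
      getElem_initialWord, Fin.val_sub_one_of_ne_zero h0.ne']
    rw [Fin.lt_def] at h0
    simp only [Fin.val_zero] at h0
    omega
  -- The repeated word in the comparison sequence is c̄, so cancelling the common prefix c⁺ leaves
  -- the bound by the reflection of c^∞.
  · have hcm : plus (reflect (initialWord s (q + 1))) =
        reflect (minus (initialWord s (q + 1))) := by
      rw [← plus_reflect_plus (minus _), plus_minus]
    rw [reflectSeq_periodicSeq (by omega), ← hcm]
    have := toLex_drop_le (q + 1) hle fun i hi => by
      unfold appendSeq
      rw [dif_pos (by omega), getElem_initialWord]
    convert this using 3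
    · rfl
    · unfold appendSeq
      rw [dif_neg (by omega), hil, Nat.add_sub_cancel]

end Desubstitution
end FundamentalWord

theorem proposition2p13 (M : ℕ) (hM : 1 ≤ M) (a : List (Fin (M + 1)))
    (ha : a ∈ FundamentalWord.fundamentalWords M) :
    FundamentalWord.IsIrreducibleSeq (FundamentalWord.periodicSeq a) ↔
      FundamentalWord.IsIrreducibleWord a := by
  constructor
  · rintro h ⟨c, hc, d, hd, rfl⟩
    exact FundamentalWord.not_isIrreducibleSeq_comp hc hd h
  · intro h
    have hV := FundamentalWord.periodicSeq_mem_V ha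
    refine ⟨hV, fun j h0 hmem => not_le.1 fun hle => h ?_⟩
    exact FundamentalWord.exists_eq_comp ha
      (FundamentalWord.isRenormalizable_of_le hV h0 hmem hle)
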